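/- **Protocol.** For $n\ge 2$ consider $n$ processors $0,1,\dots,n-1$ on a complete network, where processor $0$ is the start processor and never fails. For a permutation $\pi$ of $[n-1]=\{1,\dots,n-1\}$ and a set $F\subseteq[n-1]$ of (initially crashed) faulty processors, the protocol along $\pi$ works in synchronous rounds. Initially processor $0$ is informed and holds the list $(1,2,\dots,n-1)$. In each round every informed processor $i$ holding a nonempty list $(j_1,\dots,j_k)$ sends a request to processor $\pi(j_1)$. If $\pi(j_1)\in F$, then $i$ continues with the list $(j_2,\dots,j_k)$; otherwise $\pi(j_1)$ becomes informed and continues with the list $(j_3,j_5,\dots)$, while $i$ continues with the list $(j_2,j_4,\dots)$. The execution ends when all lists are empty; the runtime is the number of rounds performed until then. The protocol $\mathrm{GP}(\pi^1,\dots,\pi^t)$ first draws an index $i\in\{1,\dots,t\}$ uniformly at random and then runs along $\pi^i$. It is called $(f,r,T)$-safe if, for every $F\subseteq[n-1]$ with $|F|=f$, its runtime with faulty set $F$ is at most $T$ with probability at least $r$ (with respect to the random choice of $i$). **Theorem.** Let $t=t(n)\in\omega(n/\log n)$, and let $\varepsilon=\varepsilon(n)=\sqrt{\ln n/(n-1)}$;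 $\log$ denotes the logarithm to base $2$. There are functions $c=c(n)\le 6+o(1)$ and $\delta=\delta(n)$ with $\lim_{n\to\infty}\delta(n)=0$ and a function $\eta=\eta(n)\in o(1/n)$ such that for all integers $n\ge 2$ and $f\ge 0$ with $f<(n-1)(1-\varepsilon)$, with $p:=1-\frac{f}{n-1}$, the following holds: if $\pi^1,\dots,\pi^{t}$ are independent and uniformly distributed random permutations of $[n-1]$, then with probability at least $1-\eta(n)$ the protocol $\mathrm{GP}(\pi^1,\dots,\pi^{t})$ is $$\Bigl(f,\;1-\delta,\;\frac{c}{p-\varepsilon}\bigl(\lceil\log(n-1)\rceil+1\bigr)\Bigr)\text{-safe}.$$ -/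

import Mathlib

open Filter Asymptotics MeasureTheory ProbabilityTheory

namespace RumorSpreading

/-- The subsequence `(s₁, s₃, s₅, …)` of the odd indexed elements of a list `(s₁, s₂, …)`. -/
def odds {α : Type*} : List α → List α
  | [] => []
  | [a] => [a]
  | a :: _ :: l => a :: odds l

/-- The subsequence `(s₂, s₄, s₆, …)` of the even indexed elements of a list `(s₁, s₂, …)`. -/
def evens {α : Type*} : List α → List α
  | [] => []
  | [_] => []
  | _ :: b :: l => b :: evens l

/-- The state of an execution between two rounds: the informed processors, each of them with the
list of positions it still has to take care of. Processors have the names `0, 1, …, n - 1`; the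
element `j : Fin (n - 1)` stands for the number `j + 1` of `{1, …, n - 1}`. -/
abbrev State (n : ℕ) : Type := List (ℕ × List (Fin (n - 1)))

/-- What happens to a single informed processor `i` in one round. If its list `(j₁, …, jₖ)` is
nonempty, it sends a request to the processor `π j₁`. If that processor is faulty, `i` goes on with
`(j₂, …, jₖ)`. Otherwise `i` keeps the odd indexed part of `(j₂, …, jₖ)`, and the newly informed
processor `π j₁` receives the even indexed part. -/
def act {n : ℕ} (π : Equiv.Perm (Fin (n - 1))) (F : Finset (Fin (n - 1))) :
    ℕ × List (Fin (n - 1)) → State n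
  | (i, []) => [(i, [])]
  | (i, j :: l) =>
      if π j ∈ F then [(i, l)] else [(i, odds l), ((π j : ℕ) + 1, evens l)]

/-- One synchronous round: all informed processors act simultaneously. -/
def gpRound {n : ℕ} (π : Equiv.Perm (Fin (n - 1))) (F : Finset (Fin (n - 1))) (σ : State n) :
    State n :=
  σ.flatMap (act π F)

/-- At the start only processor `0` is informed, and it holds the list `(1, 2, …, n - 1)`. -/
def initial (n : ℕ) : State n := [(0, List.finRange (n - 1))]

/-- All informed processors hold empty lists, so that no further request is sent. -/
def Terminated {n : ℕ} (σ : State n) : Prop := ∀ s ∈ σ, s.2 = []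

instance {n : ℕ} (σ : State n) : Decidable (Terminated σ) :=
  inferInstanceAs (Decidable (∀ s ∈ σ, s.2 = []))

theorem length_odds_le {α : Type*} : ∀ l : List α, (odds l).length ≤ l.length
  | [] => by simp [odds]
  | [a] => by simp [odds]
  | a :: b :: l => by
      have := length_odds_le l
      simp only [odds, List.length_cons]
      omega

theorem length_evens_le {α : Type*} : ∀ l : List α, (evens l).length ≤ l.length
  | [] => by simp [evens]
  | [a] => by simp [evens]
  | a :: b :: l => by
      have := length_evens_le l
      simp only [evens, List.length_cons]
      omega

theorem length_le_of_mem_gpRound {n : ℕ} (π : Equiv.Perm (Fin (n - 1)))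
    (F : Finset (Fin (n - 1))) (σ : State n) (m : ℕ) (h : ∀ s ∈ σ, s.2.length ≤ m) :
    ∀ s ∈ gpRound π F σ, s.2.length ≤ m - 1 := by
  intro s hs
  obtain ⟨⟨i, l⟩, hl, hs⟩ := List.mem_flatMap.1 hs
  have hm := h _ hl
  cases l with
  | nil =>
    simp only [act, List.mem_singleton] at hs
    simp [hs]
  | cons j l =>
    have h1 := length_odds_le l
    have h2 := length_evens_le l
    simp only [List.length_cons] at hm
    simp only [act] at hs
    split_ifs at hs
    · simp only [List.mem_singleton] at hs
      subst hs
      simp only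
      omega
    · simp only [List.mem_cons, List.not_mem_nil, or_false] at hs
      rcases hs with rfl | rfl <;> simp only <;> omega

/-- Every execution terminates. -/
theorem exists_terminated {n : ℕ} (π : Equiv.Perm (Fin (n - 1))) (F : Finset (Fin (n - 1))) :
    ∃ k : ℕ, Terminated ((gpRound π F)^[k] (initial n)) := by
  have key : ∀ k : ℕ, ∀ s ∈ (gpRound π F)^[k] (initial n), s.2.length ≤ (n - 1) - k := by
    intro k
    induction k with
    | zero => simp [initial]
    | succ k ih =>
      rw [Function.iterate_succ_apply']
      intro s hs
      have := length_le_of_mem_gpRound π F _ _ ih s hs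
      omega
  refine ⟨n - 1, fun s hs => ?_⟩
  have := key (n - 1) s hs
  exact List.eq_nil_of_length_eq_zero (by omega)

/-- The time complexity of the execution along the permutation `π` of `{1, …, n - 1}` when exactly
the processors in `F` are faulty: the number of rounds after which no more request is sent. -/
def runtime {n : ℕ} (π : Equiv.Perm (Fin (n - 1))) (F : Finset (Fin (n - 1))) : ℕ :=
  Nat.find (exists_terminated π F)

/-- The protocol `GP(π¹, …, πᵗ)`, which draws an index `i ∈ {1, …, t}` uniformly at random and then
runs along `πⁱ`, is `(f, r, T)`-safe: for each set `F` of `f` faulty processors, its runtime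
is at most `T` with probability at least `r` over the choice of `i`. -/
def IsSafe {n t : ℕ} (π : Fin t → Equiv.Perm (Fin (n - 1))) (f : ℕ) (r T : ℝ) : Prop :=
  ∀ F : Finset (Fin (n - 1)), F.card = f →
    r ≤ (uniformOn (Set.univ : Set (Fin t))).real {i | (runtime (π i) F : ℝ) ≤ T}

/-- The random variables `X i`, with values in a finite (discrete) set, are independent, and each
of them is uniformly distributed. -/
structure IsIIDUniform {Ω ι α : Type*} [MeasurableSpace Ω] [Fintype α] (P : Measure Ω)
    (X : ι → Ω → α) : Prop where
  measurable : ∀ i a, MeasurableSet {ω | X i ω = a}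
  indep : iIndepFun (m := fun _ => (⊤ : MeasurableSpace α)) X P
  uniform : ∀ i a, P.real {ω | X i ω = a} = 1 / (Fintype.card α : ℝ)

/-- `ε = √(ln n / (n - 1))`. -/
noncomputable def eps (n : ℕ) : ℝ := Real.sqrt (Real.log n / ((n : ℝ) - 1))

/-- The runtime bound `c / (p - ε) * (⌈log₂ (n - 1)⌉ + 1)` with `p = 1 - f / (n - 1)`. -/
noncomputable def timeBound (n f : ℕ) (c : ℝ) : ℝ :=
  c / ((1 - (f : ℝ) / ((n : ℝ) - 1)) - eps n) * ((⌈Real.logb 2 ((n : ℝ) - 1)⌉ : ℝ) + 1)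

end RumorSpreading

open RumorSpreading

/-!
The bound holds with `c = 6`, by a second moment argument for a single random permutation followed
by a union bound.

Run the protocol from a list of length `k` and charge it the potential `k ^ 2`. Suppose first that
each position is faulty independently with probability `x`. A round replaces `k` by `k - 1` with
probability `x`, and splits the remaining list into two halves with probability `1 - x`, so that the
expected sum of the squared lengths shrinks at least by the factor `(1 + x) / 2` per round
(`bernoulliMean_potential_le`). Independence is available because a position is inspected only once.
With `N = n - 1` and `x = f / N`, after `6 (⌈log₂ N⌉ + 1) / (1 - x)` rounds the expectation is
`O(N ^ (-2))`, and an execution that still runs has potential at least `1`.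

For a uniformly random permutation the faulty positions form a uniformly random set of exactly `f`
elements (`card_perm_filter_mul_choose`). This is the independent model conditioned on an event of
probability at least `1 / (N + 1)`, because `f` is the mode of the binomial distribution
(`pow_self_le_succ_mul_choose`). Hence a random permutation is too slow for a given faulty set with
probability at most `1 / n` (`mul_card_perm_lt_runtime_le`). The correction `ε` is not needed for
this; it only makes the time bound larger.

Finally, if the protocol is not safe, then for some `F` more than `δ t` of the permutations are too
slow. There are at most `2 ^ n` sets `F` and `2 ^ t` sets of indices, so this has probability at
most `2 ^ (n + t) n ^ (-δ t)` (`measureReal_not_isSafe_le`). The choice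
`δ = 2 n / (t log₂ n) + 1 / log₂ n`, which tends to `0` by the growth of `t`, turns this into
`2 ^ (-n)`.
-/

namespace RumorSpreading

/-! ### The potential of an execution -/

section Potential

variable {α : Type*}

theorem odds_sublist : ∀ l : List α, (odds l).Sublist l
  | [] => by simp [odds]
  | [a] => by simp [odds]
  | a :: b :: l => by
      simpa [odds] using ((odds_sublist l).cons b)

theorem evens_sublist : ∀ l : List α, (evens l).Sublist l
  | [] => by simp [evens]
  | [a] => by simp [evens]
  | a :: b :: l => by
      simpa [evens] using ((evens_sublist l).cons_cons b).cons a

theorem length_odds : ∀ l : List α, (odds l).length = (l.length + 1) / 2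
  | [] => by simp [odds]
  | [a] => by simp [odds]
  | a :: b :: l => by
      have := length_odds l
      simp only [odds, List.length_cons]
      omega

theorem length_evens : ∀ l : List α, (evens l).length = l.length / 2
  | [] => by simp [evens]
  | [a] => by simp [evens]
  | a :: b :: l => by
      have := length_evens l
      simp only [evens, List.length_cons]
      omega

theorem two_mul_sq_length_odds_add_sq_length_evens_le (l : List α) :
    2 * ((odds l).length ^ 2 + (evens l).length ^ 2) ≤ (l.length + 1) ^ 2 := by
  rw [length_odds, length_evens]
  rcases Nat.even_or_odd' l.length with ⟨k, hk | hk⟩ <;> rw [hk]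
  · rw [show (2 * k + 1) / 2 = k by omega, show 2 * k / 2 = k by omega]
    nlinarith
  · rw [show (2 * k + 1 + 1) / 2 = k + 1 by omega, show (2 * k + 1) / 2 = k by omega]
    nlinarith

variable [DecidableEq α]

/-- The sum of the squared lengths of all lists that are left after `k` rounds when a single
processor starts with the list `l` and `G` is the set of positions held by faulty processors. -/
def potential (G : Finset α) : ℕ → List α → ℕ
  | 0, l => l.length ^ 2
  | _ + 1, [] => 0
  | k + 1, j :: l =>
      if j ∈ G then potential G k l else potential G k (odds l) + potential G k (evens l)

@[simp]
theorem potential_nil (G : Finset α) (k : ℕ) : potential G k [] = 0 := by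
  cases k <;> simp [potential]

theorem potential_congr {G G' : Finset α} (k : ℕ) :
    ∀ l : List α, (∀ a ∈ l, a ∈ G ↔ a ∈ G') → potential G k l = potential G' k l := by
  induction k with
  | zero => simp [potential]
  | succ k ih =>
    rintro (_ | ⟨j, l⟩) h
    · simp
    · have hl : ∀ a ∈ l, a ∈ G ↔ a ∈ G' := fun a ha => h a (List.mem_cons_of_mem _ ha)
      simp only [potential, h j List.mem_cons_self, ih l hl,
        ih (odds l) fun a ha => hl a ((odds_sublist l).subset ha),
        ih (evens l) fun a ha => hl a ((evens_sublist l).subset ha)]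

theorem sum_sq_length_iterate_gpRound {n : ℕ} (π : Equiv.Perm (Fin (n - 1)))
    (F : Finset (Fin (n - 1))) (k : ℕ) (σ : State n) :
    (((gpRound π F)^[k] σ).map fun s => s.2.length ^ 2).sum =
      (σ.map fun s => potential {j | π j ∈ F} k s.2).sum := by
  induction k generalizing σ with
  | zero => simp [potential]
  | succ k ih =>
    rw [Function.iterate_succ_apply, ih, gpRound, List.map_flatMap,
      List.flatMap_def, List.sum_flatten, List.map_map]
    congr 1
    refine List.map_congr_left fun s _ => ?_
    rcases s with ⟨i, _ | ⟨j, l⟩⟩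
    · simp [act]
    · by_cases h : π j ∈ F <;> simp [act, potential, h]

theorem one_le_potential_of_lt_runtime {n : ℕ} {π : Equiv.Perm (Fin (n - 1))}
    {F : Finset (Fin (n - 1))} {k : ℕ} (h : k < runtime π F) :
    1 ≤ potential {j | π j ∈ F} k (List.finRange (n - 1)) := by
  have hk := Nat.find_min (exists_terminated π F) h
  simp only [Terminated, not_forall] at hk
  obtain ⟨s, hs, hne⟩ := hk
  have hsum := sum_sq_length_iterate_gpRound π F k (initial n)
  simp only [initial, List.map_cons, List.map_nil, List.sum_cons, List.sum_nil,
    add_zero] at hsum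
  rw [← hsum]
  refine le_trans ?_ (List.le_sum_of_mem (List.mem_map_of_mem hs))
  exact Nat.one_le_pow _ _ (List.length_pos_iff.2 hne)

end Potential

/-! ### Independent faults -/

section BernoulliMean

variable {α : Type*} [Fintype α]

/-- The expected value of `h G` for a random set `G` that contains each element of `α`
independently with probability `x`. -/
noncomputable def bernoulliMean (x : ℝ) (h : Finset α → ℝ) : ℝ :=
  ∑ G : Finset α, x ^ G.card * (1 - x) ^ (Fintype.card α - G.card) * h G

theorem bernoulliMean_const (x c : ℝ) : bernoulliMean (α := α) x (fun _ => c) = c := by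
  rw [bernoulliMean, ← Finset.sum_mul, Fintype.sum_pow_mul_eq_add_pow]
  simp

theorem bernoulliMean_add (x : ℝ) (g h : Finset α → ℝ) :
    bernoulliMean x (fun G => g G + h G) = bernoulliMean x g + bernoulliMean x h := by
  simp only [bernoulliMean, mul_add, Finset.sum_add_distrib]

variable [DecidableEq α]

/-- Condition on all elements except `j`. -/
theorem bernoulliMean_eq_sum_powerset_erase (x : ℝ) (h : Finset α → ℝ) (j : α) :
    bernoulliMean x h = ∑ G ∈ (Finset.univ.erase j).powerset,
      x ^ G.card * (1 - x) ^ (Fintype.card α - 1 - G.card) *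
        ((1 - x) * h G + x * h (insert j G)) := by
  have hins : (Finset.univ : Finset (Finset α)) =
      (insert j (Finset.univ.erase j)).powerset := by
    rw [Finset.insert_erase (Finset.mem_univ j), Finset.powerset_univ]
  rw [bernoulliMean, hins, Finset.sum_powerset_insert (Finset.notMem_erase j _),
    ← Finset.sum_add_distrib]
  refine Finset.sum_congr rfl fun G hG => ?_
  have hG' := Finset.mem_powerset.1 hG
  have hj : j ∉ G := fun hj => Finset.notMem_erase j _ (hG' hj)
  have hcard := Finset.card_le_card hG'
  rw [Finset.card_erase_of_mem (Finset.mem_univ j), Finset.card_univ] at hcard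
  have hpos : 0 < Fintype.card α := Fintype.card_pos_iff.2 ⟨j⟩
  rw [Finset.card_insert_of_notMem hj,
    show Fintype.card α - G.card = Fintype.card α - 1 - G.card + 1 by omega,
    show Fintype.card α - (G.card + 1) = Fintype.card α - 1 - G.card by omega]
  ring

theorem bernoulliMean_ite_mem (x : ℝ) (j : α) (g h : Finset α → ℝ)
    (hg : ∀ G, g (insert j G) = g G) (hh : ∀ G, h (insert j G) = h G) :
    bernoulliMean x (fun G => if j ∈ G then g G else h G) =
      x * bernoulliMean x g + (1 - x) * bernoulliMean x h := by
  simp only [bernoulliMean_eq_sum_powerset_erase x _ j, Finset.mul_sum,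
    ← Finset.sum_add_distrib]
  refine Finset.sum_congr rfl fun G hG => ?_
  have hj : j ∉ G := fun hj => Finset.notMem_erase j _ (Finset.mem_powerset.1 hG hj)
  simp only [hj, Finset.mem_insert_self, if_true, if_false, hg, hh]
  ring

/-- In each round the expected potential shrinks at least by the factor `(1 + x) / 2`: a request
that is answered, which has probability `1 - x`, at least halves the sum of the squared lengths. -/
theorem bernoulliMean_potential_le {x : ℝ} (hx0 : 0 ≤ x) (hx1 : x ≤ 1) (k : ℕ) :
    ∀ l : List α, l.Nodup →
      bernoulliMean x (fun G => (potential G k l : ℝ)) ≤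
        (l.length : ℝ) ^ 2 * ((1 + x) / 2) ^ k := by
  induction k with
  | zero => intro l _; simp [potential, bernoulliMean_const]
  | succ k ih =>
    rintro (_ | ⟨j, l⟩) hl
    · simp [bernoulliMean_const]
    · obtain ⟨hj, hl⟩ := List.nodup_cons.1 hl
      have inv : ∀ l' : List α, l'.Sublist l → ∀ G : Finset α,
          potential (insert j G) k l' = potential G k l' := by
        intro l' hl' G
        refine potential_congr k l' fun a ha => ?_
        have : a ≠ j := fun h => hj (h ▸ hl'.subset ha)
        simp [this]
      have h1 := ih l hl
      have h2 := ih (odds l) (hl.sublist (odds_sublist l))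
      have h3 := ih (evens l) (hl.sublist (evens_sublist l))
      have hlen : 2 * (((odds l).length : ℝ) ^ 2 + ((evens l).length : ℝ) ^ 2) ≤
          ((l.length : ℝ) + 1) ^ 2 := by
        exact_mod_cast two_mul_sq_length_odds_add_sq_length_evens_le l
      simp only [potential, Nat.cast_ite, Nat.cast_add]
      rw [bernoulliMean_ite_mem x j (fun G => (potential G k l : ℝ))
        (fun G => (potential G k (odds l) : ℝ) + (potential G k (evens l) : ℝ))
        (fun G => by rw [inv l (List.Sublist.refl l)])
        (fun G => by rw [inv _ (odds_sublist l), inv _ (evens_sublist l)]),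
        bernoulliMean_add]
      have hr : 0 ≤ ((1 + x) / 2) ^ k := by positivity
      have hx2 : 0 ≤ 1 - x := by linarith
      calc _ ≤ x * ((l.length : ℝ) ^ 2 * ((1 + x) / 2) ^ k) +
            (1 - x) * (((odds l).length : ℝ) ^ 2 * ((1 + x) / 2) ^ k +
              ((evens l).length : ℝ) ^ 2 * ((1 + x) / 2) ^ k) := by gcongr
        _ = (x * (l.length : ℝ) ^ 2 + (1 - x) * (((odds l).length : ℝ) ^ 2 +
              ((evens l).length : ℝ) ^ 2)) * ((1 + x) / 2) ^ k := by ring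
        _ ≤ (x * ((l.length : ℝ) + 1) ^ 2 + (1 - x) * (((l.length : ℝ) + 1) ^ 2 / 2)) *
              ((1 + x) / 2) ^ k := by
            gcongr
            · linarith
            · linarith
        _ = _ := by
            rw [List.length_cons, Nat.cast_add, Nat.cast_one, pow_succ]
            ring

end BernoulliMean

/-! ### The mode of the binomial distribution -/

section BinomialMode

/-- The binomial distribution with parameters `N` and `f / N` has its mode at `f`, so that it takes
the value `f` with probability at least `1 / (N + 1)`. -/
theorem pow_self_le_succ_mul_choose {N f : ℕ} (hf : f ≤ N) :
    N ^ N ≤ (N + 1) * (f ^ f * (N - f) ^ (N - f) * N.choose f) := by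
  set g := N - f with hg
  set a : ℕ → ℕ := fun k => f ^ k * g ^ (N - k) * N.choose k with ha
  have up : ∀ k, k < f → a k ≤ a (k + 1) := by
    intro k hk
    have hc := Nat.choose_succ_right_eq N k
    refine Nat.le_of_mul_le_mul_left (?_ : (k + 1) * _ ≤ (k + 1) * _) (Nat.succ_pos k)
    have hNk : N - k = N - (k + 1) + 1 := by omega
    calc (k + 1) * a k = f ^ k * g ^ (N - (k + 1)) * N.choose k * (g * (k + 1)) := by
          simp only [ha]; rw [hNk]; ring
      _ ≤ f ^ k * g ^ (N - (k + 1)) * N.choose k * ((N - k) * f) := by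
          gcongr <;> omega
      _ = f ^ k * g ^ (N - (k + 1)) * f * (N.choose k * (N - k)) := by ring
      _ = (k + 1) * a (k + 1) := by rw [← hc]; simp only [ha]; ring
  have down : ∀ k, f ≤ k → k < N → a (k + 1) ≤ a k := by
    intro k hk hkN
    have hc := Nat.choose_succ_right_eq N k
    refine Nat.le_of_mul_le_mul_left (?_ : (k + 1) * _ ≤ (k + 1) * _) (Nat.succ_pos k)
    have hNk : N - k = N - (k + 1) + 1 := by omega
    calc (k + 1) * a (k + 1) = f ^ k * g ^ (N - (k + 1)) * f * (N.choose (k + 1) * (k + 1)) := by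
          simp only [ha]; ring
      _ = f ^ k * g ^ (N - (k + 1)) * N.choose k * ((N - k) * f) := by rw [hc]; ring
      _ ≤ f ^ k * g ^ (N - (k + 1)) * N.choose k * (g * (k + 1)) := by
          gcongr <;> omega
      _ = (k + 1) * a k := by simp only [ha]; rw [hNk]; ring
  have hmax : ∀ k ≤ N, a k ≤ a f := by
    intro k hk
    rcases le_total k f with h | h
    · exact Nat.decreasingInduction' (P := fun k => a k ≤ a f)
        (fun m hm _ ih => (up m hm).trans ih) h le_rfl
    · induction k, h using Nat.le_induction with
      | base => exact le_rfl
      | succ m hm ih => exact (down m hm (by omega)).trans (ih (by omega))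
  calc N ^ N = (f + g) ^ N := by congr 1; omega
    _ = ∑ k ∈ Finset.range (N + 1), a k := add_pow f g N
    _ ≤ ∑ _k ∈ Finset.range (N + 1), a f :=
        Finset.sum_le_sum fun k hk => hmax k (by have := Finset.mem_range.1 hk; omega)
    _ = _ := by simp [ha, hg]

theorem one_le_succ_mul_choose_mul_pow {N f : ℕ} (hN : 0 < N) (hf : f ≤ N) :
    (1 : ℝ) ≤ (N + 1) * (N.choose f *
      (((f : ℝ) / N) ^ f * (1 - (f : ℝ) / N) ^ (N - f))) := by
  have hN' : (0 : ℝ) < N := by exact_mod_cast hN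
  have h : (N : ℝ) ^ N ≤ (N + 1) * ((f : ℝ) ^ f * ((N : ℝ) - f) ^ (N - f) * N.choose f) := by
    rw [← Nat.cast_sub hf]
    exact_mod_cast pow_self_le_succ_mul_choose hf
  have h1 : 1 - (f : ℝ) / N = ((N : ℝ) - f) / N := by field_simp
  have h2 : (N : ℝ) ^ N = (N : ℝ) ^ f * (N : ℝ) ^ (N - f) := by
    rw [← pow_add]; congr 1; omega
  rw [h1, div_pow, div_pow, div_mul_div_comm, ← h2, ← mul_div_assoc, ← mul_div_assoc,
    le_div_iff₀ (by positivity), one_mul]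
  linarith

end BinomialMode

/-! ### The faulty positions under a random permutation -/

section Permutations

variable {α : Type*} [Fintype α] [DecidableEq α]

/-- For a uniformly random permutation `π` the preimage of `F` under `π` is uniformly distributed
among the sets with as many elements as `F`. -/
theorem card_perm_filter_mul_choose (F : Finset α) (Q : Finset α → Prop) [DecidablePred Q] :
    (Finset.univ.filter fun π : Equiv.Perm α => Q {j | π j ∈ F}).card *
        (Fintype.card α).choose F.card =
      Fintype.card (Equiv.Perm α) * ((Finset.univ.powersetCard F.card).filter Q).card := by
  set pre : Equiv.Perm α → Finset α := fun π => Finset.univ.filter fun j => π j ∈ F with hpre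
  have hmem : ∀ π j, j ∈ pre π ↔ π j ∈ F := by simp [hpre]
  have hmaps : ∀ π, pre π ∈ Finset.univ.powersetCard F.card := by
    intro π
    rw [Finset.mem_powersetCard_univ]
    have : pre π = F.map π.symm.toEmbedding := by
      ext j
      simp [hpre]
    rw [this, Finset.card_map]
  -- All fibres of `pre` over sets of the right size have as many elements as the one over `F`.
  have hfib : ∀ G ∈ Finset.univ.powersetCard F.card,
      (Finset.univ.filter fun π => pre π = G).card =
        (Finset.univ.filter fun π => pre π = F).card := by
    intro G hG
    rw [Finset.mem_powersetCard_univ] at hG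
    let e : {x // x ∈ G} ≃ {x // x ∈ F} := Finset.equivOfCardEq hG
    have hσ : ∀ j, e.extendSubtype j ∈ F ↔ j ∈ G := by
      intro j
      by_cases hj : j ∈ G
      · simp [hj, e.extendSubtype_mem j hj]
      · simp [hj, e.extendSubtype_not_mem j hj]
    refine Finset.card_bij' (fun π _ => π * (e.extendSubtype)⁻¹) (fun π _ => π * e.extendSubtype)
      ?_ ?_ ?_ ?_
    · intro π hπ
      have hπ : pre π = G := by simpa using hπ
      have : pre (π * (e.extendSubtype)⁻¹) = F := by
        ext j
        have h := Finset.ext_iff.1 hπ (e.extendSubtype.symm j)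
        rw [← hσ, Equiv.apply_symm_apply, hmem] at h
        rw [hmem]
        exact h
      simpa using this
    · intro π hπ
      have hπ : pre π = F := by simpa using hπ
      have : pre (π * e.extendSubtype) = G := by
        ext j
        have h := Finset.ext_iff.1 hπ (e.extendSubtype j)
        rw [hσ, hmem] at h
        rw [hmem]
        exact h
      simpa using this
    · intro π _; simp
    · intro π _; simp
  set m := (Finset.univ.filter fun π => pre π = F).card
  have h1 : Fintype.card (Equiv.Perm α) = (Fintype.card α).choose F.card * m := by
    rw [← Finset.card_univ, Finset.card_eq_sum_card_fiberwise (f := pre)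
      (t := Finset.univ.powersetCard F.card) (fun π _ => hmaps π), Finset.sum_congr rfl hfib,
      Finset.sum_const, Finset.card_powersetCard, Finset.card_univ, smul_eq_mul]
  have h2 : (Finset.univ.filter fun π : Equiv.Perm α => Q (pre π)).card =
      ((Finset.univ.powersetCard F.card).filter Q).card * m := by
    rw [Finset.card_eq_sum_card_fiberwise (f := pre)
      (t := (Finset.univ.powersetCard F.card).filter Q)
      (fun π hπ => Finset.mem_coe.2 (Finset.mem_filter.2 ⟨hmaps π, by simpa using hπ⟩)),
      ← smul_eq_mul, ← Finset.sum_const]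
    refine Finset.sum_congr rfl fun G hG => ?_
    rw [Finset.mem_filter] at hG
    rw [← hfib G hG.1, Finset.filter_filter]
    congr 1
    ext π
    simp only [Finset.mem_filter, Finset.mem_univ, true_and, and_iff_right_iff_imp]
    rintro rfl
    exact hG.2
  rw [h1]
  change (Finset.univ.filter fun π : Equiv.Perm α => Q (pre π)).card * _ = _
  rw [h2]
  ring

end Permutations
/-! ### The runtime along a single random permutation -/

section SinglePermutation

/-- With `p = 1 - x` and at least `6 (⌈log₂ N⌉ + 1) / p - 1` rounds, the bound on the expected
potential is at most `1 / (4 N ^ 2)`, because `e ^ (-3 log₂ N) ≤ N ^ (-4)`. The `- 1` accounts for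
rounding the time bound down to a natural number. -/
theorem sq_mul_pow_le {N k : ℕ} (hN : 1 ≤ N) {x : ℝ} (hx0 : 0 ≤ x)
    (hk : 6 * (⌈Real.logb 2 N⌉ + 1 : ℝ) ≤ (1 - x) * (k + 1)) :
    2 * (N : ℝ) ^ 2 * ((N : ℝ) ^ 2 * ((1 + x) / 2) ^ k) ≤ 1 / 2 := by
  have hN' : (1 : ℝ) ≤ N := by exact_mod_cast hN
  have hN0 : (0 : ℝ) < N := by linarith
  have hlog : 0 ≤ Real.log N := Real.log_nonneg hN'
  have hlogb : Real.logb 2 N ≤ (⌈Real.logb 2 N⌉ : ℝ) := Int.le_ceil _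
  have h43 : 4 / 3 * Real.log N ≤ Real.logb 2 N := by
    have h2 : 0 < Real.log 2 := Real.log_pos (by norm_num)
    have h2' := Real.log_two_lt_d9
    rw [Real.logb, le_div_iff₀ h2]
    nlinarith
  have hpow : ((1 + x) / 2) ^ k ≤ Real.exp (-5 / 2 - 4 * Real.log N) := by
    calc ((1 + x) / 2) ^ k ≤ Real.exp (-(1 - x) / 2) ^ k := by
          gcongr
          have := Real.add_one_le_exp (-(1 - x) / 2)
          linarith
      _ = Real.exp (k * (-(1 - x) / 2)) := by rw [← Real.exp_nat_mul]
      _ ≤ _ := by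
          apply Real.exp_le_exp.2
          nlinarith
  have hexp : Real.exp (-5 / 2 - 4 * Real.log N) = Real.exp (-5 / 2) / (N : ℝ) ^ 4 := by
    rw [Real.exp_sub, show 4 * Real.log N = ((4 : ℕ) : ℝ) * Real.log N by norm_num,
      Real.exp_nat_mul, Real.exp_log hN0]
  have he : Real.exp (-5 / 2) ≤ 1 / 4 := by
    have h1 : (4 : ℝ) ≤ Real.exp (5 / 2) := by
      have := Real.quadratic_le_exp_of_nonneg (x := 5 / 2) (by norm_num)
      linarith
    rw [neg_div, Real.exp_neg, one_div]
    exact inv_anti₀ (by norm_num) h1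
  rw [hexp] at hpow
  calc 2 * (N : ℝ) ^ 2 * ((N : ℝ) ^ 2 * ((1 + x) / 2) ^ k)
      ≤ 2 * (N : ℝ) ^ 2 * ((N : ℝ) ^ 2 * (Real.exp (-5 / 2) / (N : ℝ) ^ 4)) := by gcongr
    _ = 2 * Real.exp (-5 / 2) := by field_simp
    _ ≤ 1 / 2 := by linarith

/-- A uniformly random permutation is too slow for a fixed faulty set with probability at most
`1 / n`. -/
theorem mul_card_perm_lt_runtime_le {n : ℕ} (hn : 2 ≤ n) (F : Finset (Fin (n - 1))) {k : ℕ}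
    (hk : 6 * (⌈Real.logb 2 ((n : ℝ) - 1)⌉ + 1 : ℝ) ≤
      (1 - (F.card : ℝ) / ((n : ℝ) - 1)) * (k + 1)) :
    (n : ℝ) * (Finset.univ.filter fun π : Equiv.Perm (Fin (n - 1)) => k < runtime π F).card ≤
      Fintype.card (Equiv.Perm (Fin (n - 1))) := by
  classical
  obtain ⟨N, hNdef⟩ : ∃ N, N = n - 1 := ⟨_, rfl⟩
  have hcardN : Fintype.card (Fin (n - 1)) = N := by rw [Fintype.card_fin, hNdef]
  have hN : 1 ≤ N := by omega
  have hnN : (n : ℝ) - 1 = N := by rw [hNdef, Nat.cast_sub (by omega), Nat.cast_one]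
  rw [hnN] at hk
  have hN' : (1 : ℝ) ≤ N := by exact_mod_cast hN
  have hfN : F.card ≤ N := by simpa [hNdef] using Finset.card_le_univ F
  set f := F.card with hf
  set x : ℝ := (f : ℝ) / N with hx
  have hx0 : 0 ≤ x := by positivity
  have hx1 : x ≤ 1 := by
    rw [hx, div_le_one (by linarith)]
    exact_mod_cast hfN
  let Q : Finset (Fin (n - 1)) → Prop := fun G => 1 ≤ potential G k (List.finRange (n - 1))
  set b := ((Finset.univ.powersetCard f).filter Q).card with hb
  set w : ℝ := x ^ f * (1 - x) ^ (N - f) with hw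
  -- Markov's inequality, restricted to the sets with exactly `f` elements
  have hmarkov : (b : ℝ) * w ≤
      bernoulliMean x fun G => (potential G k (List.finRange (n - 1)) : ℝ) := by
    rw [bernoulliMean, hb, ← nsmul_eq_mul, ← Finset.sum_const]
    refine (Finset.sum_le_sum (g := fun G : Finset (Fin (n - 1)) => x ^ G.card *
      (1 - x) ^ (Fintype.card (Fin (n - 1)) - G.card) * (potential G k (List.finRange (n - 1)) : ℝ))
      fun G hG => ?_).trans
      (Finset.sum_le_sum_of_subset_of_nonneg (Finset.subset_univ _) fun G _ _ => ?_)
    · rw [Finset.mem_filter, Finset.mem_powersetCard_univ] at hG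
      rw [hG.1, hcardN]
      have h1 : (1 : ℝ) ≤ potential G k (List.finRange (n - 1)) := by exact_mod_cast hG.2
      have hw0 : 0 ≤ w := mul_nonneg (by positivity) (pow_nonneg (by linarith) _)
      exact le_mul_of_one_le_right hw0 h1
    · exact mul_nonneg (mul_nonneg (by positivity) (pow_nonneg (by linarith) _)) (by positivity)
  have hmean := bernoulliMean_potential_le hx0 hx1 k _ (List.nodup_finRange (n - 1))
  rw [List.length_finRange, show ((n - 1 : ℕ) : ℝ) = N by rw [hNdef]] at hmean
  have hsmall := sq_mul_pow_le hN hx0 hk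
  have hmode : (1 : ℝ) ≤ (N + 1) * (N.choose f * w) := one_le_succ_mul_choose_mul_pow hN hfN
  have hchoose : (0 : ℝ) < N.choose f := by exact_mod_cast Nat.choose_pos hfN
  have hnb : (n : ℝ) * b ≤ N.choose f := by
    have hn' : (n : ℝ) = N + 1 := by linarith
    have hbw : 2 * (N : ℝ) ^ 2 * (b * w) ≤ 1 / 2 :=
      (mul_le_mul_of_nonneg_left (hmarkov.trans hmean) (by positivity)).trans hsmall
    have hbw0 : 0 ≤ b * w := mul_nonneg (by positivity)
      (mul_nonneg (by positivity) (pow_nonneg (by linarith) _))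
    calc (n : ℝ) * b = n * b * 1 := by ring
      _ ≤ n * b * ((N + 1) * (N.choose f * w)) := by gcongr
      _ = N.choose f * ((N + 1) ^ 2 * (b * w)) := by rw [hn']; ring
      _ ≤ N.choose f * ((N + N) ^ 2 * (b * w)) := by gcongr
      _ = N.choose f * (2 * (2 * (N : ℝ) ^ 2 * (b * w))) := by ring
      _ ≤ N.choose f * (2 * (1 / 2)) := by gcongr
      _ = N.choose f := by ring
  have hcard : ((Finset.univ.filter fun π : Equiv.Perm (Fin (n - 1)) => Q {j | π j ∈ F}).card : ℝ) *
      N.choose f = Fintype.card (Equiv.Perm (Fin (n - 1))) * b := by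
    have := card_perm_filter_mul_choose F Q
    rw [hcardN] at this
    exact_mod_cast this
  have hsub : ((Finset.univ.filter fun π : Equiv.Perm (Fin (n - 1)) => k < runtime π F).card : ℝ) ≤
      (Finset.univ.filter fun π : Equiv.Perm (Fin (n - 1)) => Q {j | π j ∈ F}).card := by
    exact_mod_cast Finset.card_le_card fun π hπ => by
      simp only [Finset.mem_filter, Finset.mem_univ, true_and] at hπ ⊢
      exact one_le_potential_of_lt_runtime hπ
  refine le_of_mul_le_mul_right ?_ hchoose
  calc _ ≤ (n : ℝ) * (Finset.univ.filter fun π : Equiv.Perm (Fin (n - 1)) => Q {j | π j ∈ F}).card *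
        N.choose f := by gcongr
    _ = Fintype.card (Equiv.Perm (Fin (n - 1))) * (n * b) := by rw [mul_assoc, hcard]; ring
    _ ≤ _ := by gcongr

theorem mul_card_perm_timeBound_lt_runtime_le {n f : ℕ} (hn : 2 ≤ n)
    (hf : (f : ℝ) < ((n : ℝ) - 1) * (1 - eps n)) (F : Finset (Fin (n - 1))) (hF : F.card = f) :
    (n : ℝ) * (Finset.univ.filter fun π : Equiv.Perm (Fin (n - 1)) =>
      timeBound n f 6 < (runtime π F : ℝ)).card ≤ Fintype.card (Equiv.Perm (Fin (n - 1))) := by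
  have hn' : (2 : ℝ) ≤ n := by exact_mod_cast hn
  have heps : 0 ≤ eps n := Real.sqrt_nonneg _
  have hp : 0 < 1 - (f : ℝ) / ((n : ℝ) - 1) - eps n := by
    have : (f : ℝ) / ((n : ℝ) - 1) < 1 - eps n := by
      rw [div_lt_iff₀ (by linarith)]
      linarith
    linarith
  have hL : (0 : ℝ) ≤ ⌈Real.logb 2 ((n : ℝ) - 1)⌉ :=
    Int.cast_nonneg (Int.ceil_nonneg (Real.logb_nonneg (by norm_num) (by linarith)))
  have hT : 0 ≤ timeBound n f 6 := by unfold timeBound; positivity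
  have hfl : timeBound n f 6 ≤ ⌊timeBound n f 6⌋₊ + 1 := (Nat.lt_floor_add_one _).le
  -- Since `ε ≥ 0`, the bound is at least the one with `p` in place of `p - ε`.
  have key : 6 * (⌈Real.logb 2 ((n : ℝ) - 1)⌉ + 1 : ℝ) ≤
      (1 - (F.card : ℝ) / ((n : ℝ) - 1)) * (⌊timeBound n f 6⌋₊ + 1) := by
    rw [hF]
    calc 6 * (⌈Real.logb 2 ((n : ℝ) - 1)⌉ + 1 : ℝ) =
          (1 - (f : ℝ) / ((n : ℝ) - 1) - eps n) * timeBound n f 6 := by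
          unfold timeBound
          field_simp
      _ ≤ _ := mul_le_mul (by linarith) hfl hT (by linarith)
  simpa only [Nat.floor_lt hT] using mul_card_perm_lt_runtime_le hn F key

end SinglePermutation

/-! ### Many slow permutations are unlikely -/

section UnionBound

variable {Ω α : Type*} [MeasurableSpace Ω] [Fintype α] {P : Measure Ω}

theorem IsIIDUniform.measureReal_mem_le {ι : Type*} {X : ι → Ω → α} (hX : IsIIDUniform P X)
    (B : Finset α) (i : ι) :
    P.real (X i ⁻¹' B) ≤ B.card / (Fintype.card α : ℝ) := by
  have h : X i ⁻¹' B = ⋃ a ∈ B, {ω | X i ω = a} := by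
    ext ω
    simp
  rw [h]
  refine (measureReal_biUnion_finset_le _ _).trans ?_
  simp [hX.uniform, div_eq_mul_inv]

theorem IsIIDUniform.measureReal_forall_mem_le {ι : Type*} {X : ι → Ω → α}
    (hX : IsIIDUniform P X) {B : Finset α} {q : ℝ} (hB : B.card / (Fintype.card α : ℝ) ≤ q)
    (S : Finset ι) :
    P.real (⋂ i ∈ S, X i ⁻¹' B) ≤ q ^ S.card := by
  rw [measureReal_def, hX.indep.measure_inter_preimage_eq_mul S fun _ _ => trivial,
    ENNReal.toReal_prod]
  exact (Finset.prod_le_prod (fun i _ => ENNReal.toReal_nonneg) fun i _ =>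
    (hX.measureReal_mem_le B i).trans hB).trans_eq (Finset.prod_const q)

/-- The union bound over all index sets `S` with more than `s` elements. -/
theorem IsIIDUniform.measureReal_lt_card_filter_le [IsProbabilityMeasure P] {t : ℕ}
    {X : Fin t → Ω → α} (hX : IsIIDUniform P X) {B : Finset α} {q : ℝ} (hq0 : 0 < q) (hq1 : q ≤ 1)
    (hB : B.card / (Fintype.card α : ℝ) ≤ q) (s : ℝ) [DecidableEq α] :
    P.real {ω | s < ((Finset.univ.filter fun i => X i ω ∈ B).card : ℝ)} ≤ 2 ^ t * q ^ s := by
  classical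
  set 𝒮 : Finset (Finset (Fin t)) := Finset.univ.filter fun S => s < (S.card : ℝ)
  have hsub : {ω | s < ((Finset.univ.filter fun i => X i ω ∈ B).card : ℝ)} ⊆
      ⋃ S ∈ 𝒮, ⋂ i ∈ S, X i ⁻¹' B := by
    intro ω hω
    refine Set.mem_biUnion (x := Finset.univ.filter fun i => X i ω ∈ B) ?_ ?_
    · simpa [𝒮] using hω
    · simp
  calc _ ≤ P.real (⋃ S ∈ 𝒮, ⋂ i ∈ S, X i ⁻¹' B) := measureReal_mono hsub (measure_ne_top _ _)
    _ ≤ ∑ S ∈ 𝒮, P.real (⋂ i ∈ S, X i ⁻¹' B) := measureReal_biUnion_finset_le _ _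
    _ ≤ ∑ S ∈ 𝒮, q ^ s := by
        refine Finset.sum_le_sum fun S hS => (hX.measureReal_forall_mem_le hB S).trans ?_
        rw [← Real.rpow_natCast]
        exact Real.rpow_le_rpow_of_exponent_ge hq0 hq1 (Finset.mem_filter.1 hS).2.le
    _ = 𝒮.card * q ^ s := by rw [Finset.sum_const, nsmul_eq_mul]
    _ ≤ 2 ^ t * q ^ s := by
        gcongr
        have h := Finset.card_le_univ 𝒮
        rw [Fintype.card_finset, Fintype.card_fin] at h
        exact_mod_cast h

end UnionBound

/-! ### Safety of the protocol -/

section Safety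

theorem lt_card_filter_of_measureReal_uniformOn_lt {t : ℕ} (ht : t ≠ 0) (A : Fin t → Prop)
    [DecidablePred A] {d : ℝ} (h : (uniformOn (Set.univ : Set (Fin t))).real {i | A i} < 1 - d) :
    d * t < ((Finset.univ.filter fun i => ¬ A i).card : ℝ) := by
  have ht' : (0 : ℝ) < t := by positivity
  have hm : (uniformOn (Set.univ : Set (Fin t))).real {i | A i} =
      ((Finset.univ.filter A).card : ℝ) / t := by
    rw [measureReal_def, uniformOn_univ]
    simp [Measure.count_apply, Set.encard_eq_coe_toFinset_card]
  rw [hm, div_lt_iff₀ ht'] at h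
  have hc : ((Finset.univ.filter A).card : ℝ) + (Finset.univ.filter fun i => ¬ A i).card = t := by
    exact_mod_cast (Finset.card_filter_add_card_filter_not (s := Finset.univ) A).trans
      (Finset.card_fin t)
  linarith

/-- The union bound over the faulty sets `F`, of which there are at most `2 ^ (n - 1)`. -/
theorem measureReal_not_isSafe_le {n f t : ℕ} (hn : 2 ≤ n) (ht : t ≠ 0)
    (hf : (f : ℝ) < ((n : ℝ) - 1) * (1 - eps n)) {Ω : Type*} [MeasurableSpace Ω]
    {P : Measure Ω} [IsProbabilityMeasure P] {π : Fin t → Ω → Equiv.Perm (Fin (n - 1))}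
    (hπ : IsIIDUniform P π) (d : ℝ) :
    P.real {ω | ¬ IsSafe (fun i => π i ω) f (1 - d) (timeBound n f 6)} ≤
      2 ^ n * (2 ^ t * (1 / (n : ℝ)) ^ (d * t)) := by
  classical
  set T := timeBound n f 6
  set B : Finset (Fin (n - 1)) → Finset (Equiv.Perm (Fin (n - 1))) := fun F =>
    Finset.univ.filter fun σ => T < (runtime σ F : ℝ) with hBdef
  set 𝓕 : Finset (Finset (Fin (n - 1))) := Finset.univ.powersetCard f
  have hn' : (2 : ℝ) ≤ n := by exact_mod_cast hn
  have hsub : {ω | ¬ IsSafe (fun i => π i ω) f (1 - d) T} ⊆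
      ⋃ F ∈ 𝓕, {ω | d * t < ((Finset.univ.filter fun i => π i ω ∈ B F).card : ℝ)} := by
    intro ω hω
    simp only [Set.mem_ofPred_eq, IsSafe, not_forall, not_le] at hω
    obtain ⟨F, hF, hlt⟩ := hω
    refine Set.mem_biUnion (x := F) (Finset.mem_powersetCard_univ.2 hF) ?_
    simpa [hBdef] using lt_card_filter_of_measureReal_uniformOn_lt ht _ hlt
  calc _ ≤ P.real (⋃ F ∈ 𝓕, {ω | d * t <
          ((Finset.univ.filter fun i => π i ω ∈ B F).card : ℝ)}) :=
        measureReal_mono hsub (measure_ne_top _ _)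
    _ ≤ ∑ F ∈ 𝓕, P.real {ω | d * t <
          ((Finset.univ.filter fun i => π i ω ∈ B F).card : ℝ)} :=
        measureReal_biUnion_finset_le _ _
    _ ≤ ∑ F ∈ 𝓕, 2 ^ t * (1 / (n : ℝ)) ^ (d * t) := by
        refine Finset.sum_le_sum fun F hF => hπ.measureReal_lt_card_filter_le (by positivity)
          ((div_le_one (by linarith)).2 (by linarith)) ?_ _
        have h := mul_card_perm_timeBound_lt_runtime_le hn hf F
          (Finset.mem_powersetCard_univ.1 hF)
        rw [div_le_div_iff₀ (by exact_mod_cast Fintype.card_pos) (by linarith), one_mul]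
        linarith
    _ = 𝓕.card * (2 ^ t * (1 / (n : ℝ)) ^ (d * t)) := by rw [Finset.sum_const, nsmul_eq_mul]
    _ ≤ _ := by
        gcongr
        have h := Finset.card_le_univ 𝓕
        rw [Fintype.card_finset, Fintype.card_fin] at h
        exact_mod_cast h.trans (Nat.pow_le_pow_right (by norm_num) (Nat.sub_le n 1))

end Safety

end RumorSpreading

open RumorSpreading

theorem theorem4 (t : ℕ → ℕ)
    (ht : (fun n : ℕ => (n : ℝ) / Real.logb 2 n) =o[atTop] (fun n : ℕ => (t n : ℝ))) :
    ∃ c δ η : ℕ → ℝ,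
      (∃ e : ℕ → ℝ, Tendsto e atTop (nhds 0) ∧ ∀ n, c n ≤ 6 + e n) ∧
      Tendsto δ atTop (nhds 0) ∧
      η =o[atTop] (fun n : ℕ => 1 / (n : ℝ)) ∧
      ∀ n f : ℕ, 2 ≤ n → (f : ℝ) < ((n : ℝ) - 1) * (1 - eps n) →
        ∀ (Ω : Type*) [MeasurableSpace Ω] (P : Measure Ω) [IsProbabilityMeasure P]
          (π : Fin (t n) → Ω → Equiv.Perm (Fin (n - 1))), IsIIDUniform P π →
          1 - η n ≤ P.real {ω | IsSafe (fun i => π i ω) f (1 - δ n) (timeBound n f (c n))} := by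
  have htpos : ∀ᶠ n in atTop, t n ≠ 0 := by
    filter_upwards [ht.bound one_pos, eventually_ge_atTop 2] with n hn hn2 h0
    have hn2' : (2 : ℝ) ≤ n := by exact_mod_cast hn2
    have : 0 < (n : ℝ) / Real.logb 2 n :=
      div_pos (by linarith) (Real.logb_pos (by norm_num) (by linarith))
    simp only [h0, one_mul, Nat.cast_zero, norm_zero, norm_le_zero_iff] at hn
    exact this.ne' hn
  -- With this `δ` the exponent in the union bound is `n + t n - δ n * t n * log₂ n = -n`. If there
  -- are no permutations at all, the protocol is not safe; this happens for finitely many `n` only.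
  refine ⟨fun _ => 6, fun n => 2 * ((n : ℝ) / Real.logb 2 n / t n) + 1 / Real.logb 2 n,
    fun n => if t n = 0 then 1 else (1 / 2) ^ n, ⟨fun _ => 0, tendsto_const_nhds, by simp⟩,
    ?_, ?_, ?_⟩
  · have hlog : Tendsto (fun n : ℕ => 1 / Real.logb 2 (n : ℝ)) atTop (nhds 0) := by
      simp only [one_div]
      exact ((Real.tendsto_logb_atTop (by norm_num)).comp
        tendsto_natCast_atTop_atTop).inv_tendsto_atTop
    simpa using (ht.tendsto_div_nhds_zero.const_mul 2).add hlog
  · have h : (fun n : ℕ => (1 / 2 : ℝ) ^ n) =o[atTop] (fun n : ℕ => 1 / (n : ℝ)) := by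
      refine (isLittleO_iff_tendsto' ?_).2 ?_
      · filter_upwards [eventually_gt_atTop 0] with n hn h0
        have : (0 : ℝ) < 1 / n := by positivity
        exact absurd h0 this.ne'
      · simpa [mul_comm] using
          tendsto_self_mul_const_pow_of_lt_one (r := (1 / 2 : ℝ)) (by norm_num) (by norm_num)
    refine h.congr' ?_ EventuallyEq.rfl
    filter_upwards [htpos] with n hn
    simp [hn]
  · intro n f hn hf Ω _ P _ π hπ
    by_cases h0 : t n = 0
    · simp [h0]
    simp only [h0, if_false]
    set d := 2 * ((n : ℝ) / Real.logb 2 n / t n) + 1 / Real.logb 2 n with hd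
    set A := {ω | IsSafe (fun i => π i ω) f (1 - d) (timeBound n f 6)}
    have hbad : P.real Aᶜ ≤ 2 ^ n * (2 ^ t n * (1 / (n : ℝ)) ^ (d * t n)) :=
      measureReal_not_isSafe_le hn h0 hf hπ d
    have hcover : 1 ≤ P.real A + P.real Aᶜ := by
      have := measureReal_union_le (μ := P) A Aᶜ
      rwa [Set.union_compl_self, probReal_univ] at this
    have hn' : (2 : ℝ) ≤ n := by exact_mod_cast hn
    have hlogb : 0 < Real.logb 2 n := Real.logb_pos (by norm_num) (by linarith)
    have ht' : (t n : ℝ) ≠ 0 := by exact_mod_cast h0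
    have hpow : (1 / (n : ℝ)) ^ (d * t n) = (1 / 2) ^ (2 * n + t n) := by
      have hbase : 1 / (n : ℝ) = (1 / 2) ^ Real.logb 2 n := by
        rw [one_div, one_div, Real.inv_rpow (by norm_num),
          Real.rpow_logb (by norm_num) (by norm_num) (by linarith)]
      rw [hbase, ← Real.rpow_mul (by norm_num), ← Real.rpow_natCast]
      congr 1
      rw [hd]
      push_cast
      field_simp
    have hval : 2 ^ n * (2 ^ t n * (1 / (n : ℝ)) ^ (d * t n)) = (1 / 2) ^ n := by
      rw [hpow, pow_add, two_mul, pow_add]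
      simp only [one_div, inv_pow]
      field_simp
    linarith
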